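/- Let $\mathcal A$ be a finite alphabet, and let $\mathsf X\subseteq\mathcal A^{\mathbf Z}$ be a (two-sided) subshift, i.e. a closed shift-invariant subset, with language $\mathcal B(\mathsf X)$ (the finite words, including the empty one, that occur in points of $\mathsf X$). A subshift is of finite type (an SFT) if it can be defined by a finite set of forbidden words; a factor map between subshifts is a continuous surjection that commutes with the shift maps. Assume that: - $\mathsf X$ is irreducible: for all $u,w\in\mathcal B(\mathsf X)$ there is $v\in\mathcal B(\mathsf X)$ with $uvw\in\mathcal B(\mathsf X)$; - $\mathsf X$ is strictly sofic: it is the image of an SFT under a factor map, but is not itself an SFT; - $\mathsf X$ is of almost finite type (AFT): there are an irreducible SFT $\mathsf Y$ and a factor map $\pi:\mathsf Y\to\mathsf X$ that is one-to-one on some nonempty open subset of $\mathsf Y$. Let $\mathsf X^+$ and $\mathsf X^-$ be the sets of right-rays $x_0x_1x_2\dots$ and of left-rays $\dots x_{-2}x_{-1}$ of points $x\in\mathsf X$, and for $x^+\in\mathsf X^+$ let $P_\infty(x^+)=\{y^-\in\mathsf X^- : y^-x^+\in\mathsf X\}$ be its predecessor set. The left Krieger cover of $\mathsf X$ is the labelled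 directed graph whose vertices are the predecessor sets $P_\infty(x^+)$, $x^+\in\mathsf X^+$, with an edge labelled $a\in\mathcal A$ from $P_\infty(x^+)$ to $P_\infty(y^+)$ if and only if $ay^+\in\mathsf X^+$ and $P_\infty(x^+)=P_\infty(ay^+)$. Then the left Krieger cover of $\mathsf X$ is a reducible graph: there are vertices $p,q$ such that there is no finite directed path (of length $\ge 0$) from $p$ to $q$. -/

import Mathlib

open SymbolicDynamics.FullShift

universe u

/-- A directed graph: vertices, edges, and the source and range of each edge. -/
structure DirectedGraph where
  Vertex : Type u
  Edge : Type u
  source : Edge → Vertex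
  range : Edge → Vertex

namespace DirectedGraph

/-- `G.IsPath p v w`: the edges in the list `p` form, in this order, a finite directed path from
`v` to `w`. The vertices are the paths of length zero. -/
def IsPath (G : DirectedGraph.{u}) : List G.Edge → G.Vertex → G.Vertex → Prop
  | [], v, w => v = w
  | e :: p, v, w => G.source e = v ∧ G.IsPath p (G.range e) w

/-- Every ordered pair of vertices is joined by a finite directed path. -/
def IsIrreducible (G : DirectedGraph.{u}) : Prop :=
  ∀ v w : G.Vertex, ∃ p : List G.Edge, G.IsPath p v w

/-- A directed graph is reducible if it is not irreducible. -/
def IsReducible (G : DirectedGraph.{u}) : Prop :=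
  ¬ G.IsIrreducible

end DirectedGraph

/-- A directed graph with edges labelled by letters of `A`. -/
structure LabelledGraph (A : Type u) extends DirectedGraph.{u} where
  label : Edge → A

/-- The bi-infinite sequence `y⁻ x⁺` with `x⁺ = x 0, x 1, x 2, …` in the coordinates `0, 1, 2, …`
and `y⁻ = …, y 2, y 1, y 0` in the coordinates `…, -3, -2, -1`. -/
def glueRays {A : Type*} (y x : ℕ → A) : ℤ → A
  | Int.ofNat n => x n
  | Int.negSucc n => y n

/-- The right-infinite ray `a x⁺`. -/
def consRay {A : Type*} (a : A) (x : ℕ → A) : ℕ → A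
  | 0 => a
  | n + 1 => x n

/-- The finite word `w` occurs in the bi-infinite sequence `x`. -/
def WordOccursIn {A : Type*} (w : List A) (x : ℤ → A) : Prop :=
  ∃ i : ℤ, ∀ (k : ℕ) (hk : k < w.length), x (i + k) = w[k]

namespace SymbolicDynamics.FullShift.Subshift

section Basic

variable {A : Type*} [TopologicalSpace A]

/-- The language of `X`: all finite words (including the empty one, if `X` is nonempty) occurring
in points of `X`. -/
def language (X : Subshift A ℤ) : Set (List A) :=
  {w | ∃ x ∈ X.carrier, WordOccursIn w x}

/-- For all words `u`, `w` of `X` there is a word `v` of `X` such that `uvw` is a word of `X`. -/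
def IsIrreducible (X : Subshift A ℤ) : Prop :=
  ∀ u ∈ X.language, ∀ w ∈ X.language, ∃ v ∈ X.language, u ++ v ++ w ∈ X.language

/-- `X` is a shift of finite type: it is defined by a finite set of forbidden words. -/
def IsFiniteType (X : Subshift A ℤ) : Prop :=
  ∃ F : Set (List A), F.Finite ∧ X.carrier = {x | ∀ w ∈ F, ¬ WordOccursIn w x}

/-- The shift map `σ : X → X`, `(σ x) i = x (1 + i)`. -/
def shiftMap (X : Subshift A ℤ) : X.carrier → X.carrier :=
  (X.mapsTo 1).restrict

/-- A factor map: a continuous surjection that commutes with the shift maps. -/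
def IsFactorMap {B : Type*} [TopologicalSpace B] {Y : Subshift B ℤ} {X : Subshift A ℤ}
    (π : Y.carrier → X.carrier) : Prop :=
  Continuous π ∧ Function.Surjective π ∧ ∀ y, π (Y.shiftMap y) = X.shiftMap (π y)

/-- `X` is sofic: it is the image under a factor map of a shift of finite type over some finite
alphabet. -/
def IsSofic (X : Subshift A ℤ) : Prop :=
  ∃ (B : Type) (_ : Finite B) (_ : TopologicalSpace B) (_ : DiscreteTopology B)
    (Y : Subshift B ℤ) (π : Y.carrier → X.carrier), Y.IsFiniteType ∧ IsFactorMap π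

/-- `X` is sofic but not of finite type. -/
def IsStrictlySofic (X : Subshift A ℤ) : Prop :=
  X.IsSofic ∧ ¬ X.IsFiniteType

/-- `X` is of almost finite type: it is the image of an irreducible shift of finite type over some
finite alphabet under a factor map that is one-to-one on some nonempty open set. -/
def IsAlmostFiniteType (X : Subshift A ℤ) : Prop :=
  ∃ (B : Type) (_ : Finite B) (_ : TopologicalSpace B) (_ : DiscreteTopology B)
    (Y : Subshift B ℤ) (π : Y.carrier → X.carrier),
    Y.IsFiniteType ∧ Y.IsIrreducible ∧ IsFactorMap π ∧
      ∃ U : Set Y.carrier, IsOpen U ∧ U.Nonempty ∧ Set.InjOn π U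

/-- The right-rays `z 0, z 1, z 2, …` of points `z` of `X`. -/
def rightRays (X : Subshift A ℤ) : Set (ℕ → A) :=
  {x | ∃ z ∈ X.carrier, ∀ n : ℕ, x n = z n}

/-- The left-rays `…, z (-2), z (-1)` of points `z` of `X`, read from right to left. -/
def leftRays (X : Subshift A ℤ) : Set (ℕ → A) :=
  {y | ∃ z ∈ X.carrier, ∀ n : ℕ, y n = z (-(n + 1))}

/-- The predecessor set of a right-ray `x⁺`: all left-rays `y⁻` with `y⁻ x⁺` in `X`. -/
def predecessorSet (X : Subshift A ℤ) (x : ℕ → A) : Set (ℕ → A) :=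
  {y | y ∈ X.leftRays ∧ glueRays y x ∈ X.carrier}

end Basic

/-- The left Krieger cover of `X`. The vertices are the predecessor sets of right-rays of `X`. There
is an edge labelled `a` from the vertex `P` to the vertex `Q` iff, for a right-ray `y` of `X` with
predecessor set `Q`, the ray `a y` is a right-ray of `X` with predecessor set `P`. -/
def leftKriegerCover {A : Type u} [TopologicalSpace A] (X : Subshift A ℤ) : LabelledGraph A where
  Vertex := {P : Set (ℕ → A) // ∃ x ∈ X.rightRays, P = X.predecessorSet x}
  Edge := {e : Set (ℕ → A) × A × Set (ℕ → A) // ∃ y ∈ X.rightRays,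
    consRay e.2.1 y ∈ X.rightRays ∧
      e.1 = X.predecessorSet (consRay e.2.1 y) ∧ e.2.2 = X.predecessorSet y}
  source e := ⟨e.1.1, by obtain ⟨y, -, h, h₁, -⟩ := e.2; exact ⟨_, h, h₁⟩⟩
  range e := ⟨e.1.2.2, by obtain ⟨y, h, -, -, h₂⟩ := e.2; exact ⟨_, h, h₂⟩⟩
  label e := e.1.2.1

end SymbolicDynamics.FullShift.Subshift

/-! Suppose the left Krieger cover is irreducible; then `X` turns out to be of finite type. Write
P(r) for the predecessor set of r. Almost finite type yields a finite graph presenting `X` in which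
the labels and a single vertex determine a bi-infinite path
(`IsAlmostFiniteType.exists_presentation`). Compactness makes this quantitative: two paths that meet
in an interval where their labels agree coincide at distance at least D from its ends
(`PathsSeparated.exists_delay`). Moreover there is a magic word: a lift of one point can be matched,
at an occurrence of the word, by a lift of any other point containing it
(`PathsSeparated.exists_magic`).

If `X` is not of finite type, some right-ray x is a limit of right-rays with one common predecessor
set V ≠ P(x), and V ⊆ P(x) since `X` is closed. Choose y with P(y) = V that agrees with x on 2D+1
letters, and s in P(x) but not in V. Irreducibility of the cover
(`exists_predecessorSet_eq_of_isIrreducible`) allows the magic word to be placed in s, in some z in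
V, and in the tail of a ray g with P(g) = P(x) and the same 2D+1 initial letters as x. Now sx, sg,
zg, zy all lie in `X`, and consecutive ones share a magic word, in s, g and z respectively. Lifts
chosen to meet there all pass through the same vertex at coordinate D. Following the lift of sx up
to D and that of zy afterwards presents sy, contradicting the choice of s. -/

/-! ### Compactness of the full shift -/

section Compactness

/-- A cylinder inside an open set of the full shift. -/
lemma IsOpen.exists_window_subset {B : Type*} [TopologicalSpace B] [DiscreteTopology B]
    {O : Set (ℤ → B)} (hO : IsOpen O) {x : ℤ → B} (hx : x ∈ O) :
    ∃ K : ℕ, ∀ y : ℤ → B, (∀ j : ℤ, -K ≤ j → j ≤ K → y j = x j) → y ∈ O := by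
  obtain ⟨J, v, hv, hJ⟩ := isOpen_pi_iff.1 hO x hx
  refine ⟨J.sup Int.natAbs, fun y hy => hJ ?_⟩
  intro j hj
  have h : j.natAbs ≤ J.sup Int.natAbs := Finset.le_sup (f := Int.natAbs) hj
  rw [hy j (by omega) (by omega)]
  exact (hv j hj).2

/-- A closed set of the full shift contains every sequence all of whose central windows occur as
central windows of points of the set. -/
lemma IsClosed.mem_of_windows {B : Type*} [TopologicalSpace B] [DiscreteTopology B]
    {Z : Set (ℤ → B)} (hZ : IsClosed Z) {x : ℤ → B}
    (hx : ∀ K : ℕ, ∃ y ∈ Z, ∀ j : ℤ, -K ≤ j → j ≤ K → y j = x j) : x ∈ Z := by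
  by_contra h
  obtain ⟨K, hK⟩ := hZ.isOpen_compl.exists_window_subset (x := x) h
  obtain ⟨y, hy, hyx⟩ := hx K
  exact hK y hyx hy

/-- Every sequence of points of the full shift over a finite alphabet has a cluster point. -/
lemma exists_clusterSeq {B : Type*} [Finite B] (c : ℕ → ℤ → B) :
    ∃ d : ℤ → B, ∀ N : ℕ, ∃ n ≥ N, ∀ j : ℤ, -N ≤ j → j ≤ N → c n j = d j := by
  let _ : TopologicalSpace B := ⊥
  have : DiscreteTopology B := ⟨rfl⟩
  obtain ⟨d, -, φ, hφ, hd⟩ := isCompact_univ.tendsto_subseq (x := c) (fun _ => Set.mem_univ _)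
  refine ⟨d, fun N => ?_⟩
  have h : ∀ᶠ n in Filter.atTop, ∀ j ∈ Set.Icc (-N : ℤ) N, c (φ n) j = d j := by
    refine (Filter.eventually_all_finite (Set.finite_Icc _ _)).2 fun j _ => ?_
    have := (tendsto_pi_nhds.1 hd) j
    rw [nhds_discrete] at this
    exact Filter.tendsto_pure.1 this
  obtain ⟨n, hn, hnN⟩ := (h.and (Filter.eventually_ge_atTop N)).exists
  exact ⟨φ n, hnN.trans (hφ.id_le n), fun j h₁ h₂ => hn j ⟨h₁, h₂⟩⟩

end Compactness

/-! ### Bi-infinite paths, closing delays and magic words -/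

section Paths

variable {C A : Type*} {T : C → C → Prop} {l : C → A}

/-- `c` is a bi-infinite path of the relation `T`. -/
def IsBiinfinitePath (T : C → C → Prop) (c : ℤ → C) : Prop := ∀ i, T (c i) (c (i + 1))

lemma IsBiinfinitePath.translate {c : ℤ → C} (hc : IsBiinfinitePath T c) (n : ℤ) :
    IsBiinfinitePath T (fun i => c (i + n)) := by
  intro i
  have := hc (i + n)
  rwa [show i + n + 1 = i + 1 + n by ring] at this

lemma IsBiinfinitePath.splice {c d : ℤ → C} (hc : IsBiinfinitePath T c)
    (hd : IsBiinfinitePath T d) {i : ℤ} (h : c i = d i) :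
    IsBiinfinitePath T (fun j => if j ≤ i then c j else d j) := by
  intro j
  rcases lt_trichotomy j i with hj | rfl | hj
  · simpa [show j ≤ i by omega, show j + 1 ≤ i by omega] using hc j
  · simpa [h] using hd j
  · simpa [show ¬ j ≤ i by omega, show ¬ j + 1 ≤ i by omega] using hd j

lemma IsBiinfinitePath.of_windows {c : ℤ → C}
    (h : ∀ N : ℕ, ∃ d, IsBiinfinitePath T d ∧ ∀ j : ℤ, -N ≤ j → j ≤ N → d j = c j) :
    IsBiinfinitePath T c := by
  intro i
  obtain ⟨d, hd, hdc⟩ := h (i.natAbs + 1)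
  rw [← hdc i (by omega) (by omega), ← hdc (i + 1) (by omega) (by omega)]
  exact hd i

lemma IsBiinfinitePath.reverse {c : ℤ → C} (hc : IsBiinfinitePath T c) (n : ℤ) :
    IsBiinfinitePath (flip T) (fun i => c (n - i)) := by
  intro i
  have := hc (n - (i + 1))
  rwa [show n - (i + 1) + 1 = n - i by ring] at this

/-- Two bi-infinite paths with the same labels that meet are equal. -/
def PathsSeparated (T : C → C → Prop) (l : C → A) : Prop :=
  ∀ c, IsBiinfinitePath T c → ∀ d, IsBiinfinitePath T d →
    (∀ i, l (c i) = l (d i)) → c 0 = d 0 → c = d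

lemma PathsSeparated.eq_of_apply_eq (hs : PathsSeparated T l) {c d : ℤ → C}
    (hc : IsBiinfinitePath T c) (hd : IsBiinfinitePath T d) (hl : ∀ i, l (c i) = l (d i))
    {i : ℤ} (h : c i = d i) : c = d := by
  have := hs _ (hc.translate i) _ (hd.translate i) (fun _ => hl _) (by simpa using h)
  funext j
  simpa using congrFun this (j - i)

lemma PathsSeparated.flip (hs : PathsSeparated T l) : PathsSeparated (flip T) l := by
  intro c hc d hd hl h
  have := hs _ (hc.reverse 0) _ (hd.reverse 0) (fun _ => hl _) (by simpa using h)
  funext j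
  simpa using congrFun this (-j)

/-- The labelling of the bi-infinite paths is one-to-one on some cylinder. -/
def LocallyInjective (T : C → C → Prop) (l : C → A) : Prop :=
  ∃ d, IsBiinfinitePath T d ∧ ∃ K : ℕ, ∀ c, IsBiinfinitePath T c → ∀ c', IsBiinfinitePath T c' →
    (∀ j : ℤ, -K ≤ j → j ≤ K → c j = d j) → (∀ j : ℤ, -K ≤ j → j ≤ K → c' j = d j) →
      (∀ j, l (c j) = l (c' j)) → c = c'

/-- Any two vertices on bi-infinite paths are joined by a bi-infinite path. -/
def PathTransitive (T : C → C → Prop) : Prop :=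
  ∀ c, IsBiinfinitePath T c → ∀ d, IsBiinfinitePath T d → ∃ e, IsBiinfinitePath T e ∧ ∃ n : ℕ,
    e 0 = c 0 ∧ e n = d 0

lemma LocallyInjective.flip (h : LocallyInjective T l) : LocallyInjective (flip T) l := by
  obtain ⟨d, hd, K, h⟩ := h
  refine ⟨_, hd.reverse 0, K, fun c hc c' hc' h₁ h₂ hl => ?_⟩
  have := h _ (hc.reverse 0) _ (hc'.reverse 0)
    (fun j _ _ => by simpa using h₁ (0 - j) (by omega) (by omega))
    (fun j _ _ => by simpa using h₂ (0 - j) (by omega) (by omega)) (fun _ => hl _)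
  funext j
  simpa using congrFun this (-j)

lemma PathTransitive.flip (h : PathTransitive T) : PathTransitive (flip T) := by
  intro c hc d hd
  obtain ⟨e, he, n, h₁, h₂⟩ := h _ (hd.reverse 0) _ (hc.reverse 0)
  exact ⟨_, he.reverse n, n, by simpa using h₂, by simpa using h₁⟩

/-- Both futures can be given a common past through the cylinder of injectivity: follow `d` across
its central window, a connecting path to `c 0`, then `c` or `c'`. The two resulting paths have equal
labels, hence are equal. -/
lemma LocallyInjective.eq_of_nonneg (hi : LocallyInjective T l) (ht : PathTransitive T)
    {c c' : ℤ → C} (hc : IsBiinfinitePath T c) (hc' : IsBiinfinitePath T c')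
    (hl : ∀ i, l (c i) = l (c' i)) (h : c 0 = c' 0) {i : ℤ} (hi0 : 0 ≤ i) : c i = c' i := by
  obtain ⟨d, hd, K, hK⟩ := hi
  obtain ⟨e, he, n, he₀, hen⟩ := ht _ (hd.translate K) _ hc
  have key : ∀ b, IsBiinfinitePath T b → e n = b 0 →
      IsBiinfinitePath T (fun j : ℤ =>
        if j ≤ K then d j else if j ≤ K + n then e (j + -K) else b (j + -(K + n))) := by
    intro b hb hen
    refine hd.splice (((he.translate (-K)).splice (hb.translate (-(K + n))) (i := K + n) ?_)) ?_
    · simpa using hen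
    · simpa using he₀.symm
  have := hK _ (key c hc hen) _ (key c' hc' (hen.trans h)) (fun j _ hj => by simp [hj])
    (fun j _ hj => by simp [hj]) (fun j => by split_ifs <;> simp [hl])
  rcases hi0.eq_or_lt with rfl | hi0
  · exact h
  · have := congrFun this (i + (K + n))
    simpa only [show ¬ (i + (K + n) ≤ K) by omega, show ¬ (i + (K + n) ≤ K + n) by omega,
      if_false, add_neg_cancel_right] using this

/-- A transitive relation with a locally injective labelling has separated paths. -/
lemma LocallyInjective.pathsSeparated (hi : LocallyInjective T l) (ht : PathTransitive T) :
    PathsSeparated T l := by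
  intro c hc d hd hl h
  funext j
  rcases le_total 0 j with hj | hj
  · exact hi.eq_of_nonneg ht hc hd hl h hj
  · have := hi.flip.eq_of_nonneg ht.flip (hc.reverse 0) (hd.reverse 0) (fun _ => hl _)
      (by simpa using h) (i := -j) (by omega)
    simpa using this

/-- The bi-infinite paths labelled `x`. -/
def pathFiber (T : C → C → Prop) (l : C → A) (x : ℤ → A) : Set (ℤ → C) :=
  {c | IsBiinfinitePath T c ∧ ∀ i, l (c i) = x i}

lemma PathsSeparated.injOn_apply (hs : PathsSeparated T l) (x : ℤ → A) (i : ℤ) :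
    Set.InjOn (fun c : ℤ → C => c i) (pathFiber T l x) :=
  fun _ hc _ hd h => hs.eq_of_apply_eq hc.1 hd.1 (fun j => (hc.2 j).trans (hd.2 j).symm) h

variable [Finite C]

/-- If no delay worked, a cluster point of the counterexamples would be a pair of paths that meet at
0, have equal labels from 0 on, and differ at 1. -/
lemma PathsSeparated.exists_step_delay (hs : PathsSeparated T l) :
    ∃ D : ℕ, ∀ c, IsBiinfinitePath T c → ∀ d, IsBiinfinitePath T d → ∀ i : ℤ, c i = d i →
      (∀ j, i ≤ j → j ≤ i + D → l (c j) = l (d j)) → c (i + 1) = d (i + 1) := by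
  by_contra! hcon
  have : ∀ D : ℕ, ∃ p : ℤ → C × C, IsBiinfinitePath T (fun i => (p i).1) ∧
      IsBiinfinitePath T (fun i => (p i).2) ∧ (p 0).1 = (p 0).2 ∧
      (∀ j : ℤ, 0 ≤ j → j ≤ D → l (p j).1 = l (p j).2) ∧ (p 1).1 ≠ (p 1).2 := by
    intro D
    obtain ⟨c, hc, d, hd, i, h, hl, hne⟩ := hcon D
    refine ⟨fun j => (c (j + i), d (j + i)), hc.translate i, hd.translate i, by simpa using h,
      fun j h₁ h₂ => hl _ (by omega) (by omega), ?_⟩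
    simpa [add_comm] using hne
  choose p hp₁ hp₂ hp₀ hpl hpne using this
  obtain ⟨q, hq⟩ := exists_clusterSeq p
  have hq₁ : IsBiinfinitePath T (fun i => (q i).1) := .of_windows fun N => by
    obtain ⟨n, -, h⟩ := hq N
    exact ⟨_, hp₁ n, fun j h₁ h₂ => by rw [h j h₁ h₂]⟩
  have hq₂ : IsBiinfinitePath T (fun i => (q i).2) := .of_windows fun N => by
    obtain ⟨n, -, h⟩ := hq N
    exact ⟨_, hp₂ n, fun j h₁ h₂ => by rw [h j h₁ h₂]⟩
  obtain ⟨n, -, hn⟩ := hq 1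
  have h₀ : (q 0).1 = (q 0).2 := by rw [← hn 0 (by simp) (by simp)]; exact hp₀ n
  have h₁ : (q 1).1 ≠ (q 1).2 := by rw [← hn 1 (by simp) (by simp)]; exact hpne n
  have hl : ∀ j : ℤ, 0 ≤ j → l (q j).1 = l (q j).2 := by
    intro j hj
    obtain ⟨n, hN, hn⟩ := hq j.natAbs
    rw [← hn j (by omega) (by omega)]
    exact hpl n j hj (by omega)
  -- Nothing is known about the labels of the pair before 0, so the second path is given the past of
  -- the first.
  have := hs _ hq₁ _ (hq₁.splice hq₂ (i := 0) h₀)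
    (fun i => by
      by_cases hi : i ≤ 0
      · simp [hi]
      · simpa [hi] using hl i (by omega)) (by simp)
  exact h₁ (by simpa using congrFun this 1)

lemma PathsSeparated.exists_right_delay (hs : PathsSeparated T l) :
    ∃ D : ℕ, ∀ c, IsBiinfinitePath T c → ∀ d, IsBiinfinitePath T d → ∀ i k : ℤ, c i = d i →
      (∀ j, i ≤ j → j ≤ k → l (c j) = l (d j)) → ∀ j, i ≤ j → j + D ≤ k → c j = d j := by
  obtain ⟨D, hD⟩ := hs.exists_step_delay
  refine ⟨D, fun c hc d hd i k h hl j hij => ?_⟩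
  induction j, hij using Int.leInduction with
  | base => exact fun _ => h
  | succ j hij ih =>
    intro hjk
    exact hD c hc d hd j (ih (by omega)) fun m h₁ h₂ => hl m (by omega) (by omega)

/-- Paths that meet inside an interval on which their labels agree coincide away from the ends of
that interval. -/
lemma PathsSeparated.exists_delay (hs : PathsSeparated T l) :
    ∃ D : ℕ, ∀ c, IsBiinfinitePath T c → ∀ d, IsBiinfinitePath T d → ∀ i k m : ℤ, c i = d i →
      k ≤ i → i ≤ m → (∀ j, k ≤ j → j ≤ m → l (c j) = l (d j)) →
        ∀ j, k + D ≤ j → j + D ≤ m → c j = d j := by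
  obtain ⟨D₁, h₁⟩ := hs.exists_right_delay
  obtain ⟨D₂, h₂⟩ := hs.flip.exists_right_delay
  refine ⟨max D₁ D₂, fun c hc d hd i k m h hk hm hl j hkj hjm => ?_⟩
  rcases le_total i j with hij | hij
  · exact h₁ c hc d hd i m h (fun j _ _ => hl j (by omega) (by omega)) j hij (by omega)
  · have := h₂ _ (hc.reverse 0) _ (hd.reverse 0) (-i) (-k) (by simpa using h)
      (fun j _ _ => hl _ (by omega) (by omega)) (-j) (by omega) (by omega)
    simpa using this

/-- There is a magic word: a lift of a sequence containing the word can be transferred to any other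
sequence containing it. -/
lemma PathsSeparated.exists_magic (hs : PathsSeparated T l) (hne : ∃ c, IsBiinfinitePath T c) :
    ∃ p, IsBiinfinitePath T p ∧ ∃ L : ℕ, ∀ c, IsBiinfinitePath T c → ∀ d, IsBiinfinitePath T d →
      ∀ i k : ℤ, (∀ j : ℤ, -L ≤ j → j ≤ L → l (c (i + j)) = l (p j)) →
        (∀ j : ℤ, -L ≤ j → j ≤ L → l (d (k + j)) = l (p j)) →
          ∃ e, IsBiinfinitePath T e ∧ (∀ j, l (e j) = l (d j)) ∧ e k = c i := by
  classical
  have hex : ∃ n : ℕ, ∃ c, IsBiinfinitePath T c ∧ (pathFiber T l (l ∘ c)).ncard = n :=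
    let ⟨c, hc⟩ := hne; ⟨_, c, hc, rfl⟩
  -- The label sequence of `p` has the fewest lifts. Fibers inject into the finite set `C` by
  -- evaluation at a coordinate, so `ncard` is a true count.
  obtain ⟨p, hp, hpn⟩ := Nat.find_spec hex
  have hmin : ∀ c, IsBiinfinitePath T c →
      (pathFiber T l (l ∘ p)).ncard ≤ (pathFiber T l (l ∘ c)).ncard := fun c hc => by
    rw [hpn]; exact Nat.find_min' hex ⟨c, hc, rfl⟩
  set S : Set C := (fun c : ℤ → C => c 0) '' pathFiber T l (l ∘ p) with hS
  have hScard : S.ncard = (pathFiber T l (l ∘ p)).ncard := (hs.injOn_apply _ 0).ncard_image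
  -- By compactness, a long enough central window of the labels of `p` already forces the central
  -- vertex into `S`.
  have hL : ∃ L : ℕ, ∀ c, IsBiinfinitePath T c →
      (∀ j : ℤ, -L ≤ j → j ≤ L → l (c j) = l (p j)) → c 0 ∈ S := by
    by_contra! hcon
    choose c hc hcl hcS using hcon
    obtain ⟨q, hq⟩ := exists_clusterSeq c
    obtain ⟨n, -, hn⟩ := hq 0
    refine hcS n ⟨q, ⟨.of_windows fun N => ?_, fun i => ?_⟩, (hn 0 (by simp) (by simp)).symm⟩
    · obtain ⟨n, -, h⟩ := hq N
      exact ⟨_, hc n, h⟩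
    · obtain ⟨n, hN, hn⟩ := hq i.natAbs
      rw [← hn i (by omega) (by omega)]
      exact hcl n i (by omega) (by omega)
  obtain ⟨L, hL⟩ := hL
  have hL' : ∀ c, IsBiinfinitePath T c → ∀ i : ℤ,
      (∀ j : ℤ, -L ≤ j → j ≤ L → l (c (i + j)) = l (p j)) → c i ∈ S := by
    intro c hc i h
    simpa using hL _ (hc.translate i) fun j h₁ h₂ => by rw [add_comm]; exact h j h₁ h₂
  refine ⟨p, hp, L, fun c hc d hd i k hci hdk => ?_⟩
  have hsub : (fun c : ℤ → C => c k) '' pathFiber T l (l ∘ d) ⊆ S := by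
    rintro _ ⟨e, he, rfl⟩
    exact hL' e he.1 k fun j h₁ h₂ => (he.2 _).trans (hdk j h₁ h₂)
  -- By minimality the lifts of the labels of `d` occupy at least as many vertices at `k` as `S`
  -- has, so they occupy all of `S`, in particular `c i`.
  have heq := Set.eq_of_subset_of_ncard_le hsub (by
    rw [(hs.injOn_apply _ k).ncard_image, hScard]; exact hmin d hd)
  obtain ⟨e, he, hek⟩ := heq.symm ▸ hL' c hc i hci
  exact ⟨e, he.1, he.2, hek⟩

end Paths

/-! ### Recoding an almost finite type shift as a labelled graph -/

namespace SymbolicDynamics.FullShift.Subshift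

section Recoding

variable {A B : Type*} [TopologicalSpace A] [TopologicalSpace B]

lemma translate_mem {X : Subshift A ℤ} {x : ℤ → A} (hx : x ∈ X.carrier) (n : ℤ) :
    (fun i => x (n + i)) ∈ X.carrier :=
  X.mapsTo n hx

lemma translate_mem_iff {X : Subshift A ℤ} {x : ℤ → A} (n : ℤ) :
    (fun i => x (n + i)) ∈ X.carrier ↔ x ∈ X.carrier :=
  ⟨fun h => by simpa using translate_mem h (-n), fun h => translate_mem h n⟩

lemma IsFiniteType.exists_memory {Y : Subshift B ℤ} (hY : Y.IsFiniteType) :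
    ∃ R : ℕ, ∀ y : ℤ → B,
      (∀ i : ℤ, ∃ z ∈ Y.carrier, ∀ j : ℤ, -R ≤ j → j ≤ R → z j = y (i + j)) → y ∈ Y.carrier := by
  obtain ⟨F, hF, hYF⟩ := hY
  obtain ⟨R, hR⟩ := (hF.image List.length).bddAbove
  refine ⟨R, fun y hy => ?_⟩
  rw [hYF]
  rintro w hw ⟨i, hi⟩
  obtain ⟨z, hz, hzy⟩ := hy i
  have hwR : w.length ≤ R := hR (Set.mem_image_of_mem _ hw)
  rw [hYF] at hz
  refine hz w hw ⟨0, fun k hk => ?_⟩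
  rw [zero_add, hzy k (by omega) (by omega)]
  exact hi k hk

lemma IsIrreducible.exists_windows {Y : Subshift B ℤ} (hY : Y.IsIrreducible) {u v : ℤ → B}
    (hu : u ∈ Y.carrier) (hv : v ∈ Y.carrier) (K : ℕ) :
    ∃ q ∈ Y.carrier, ∃ a b : ℤ, a ≤ b ∧ (∀ j : ℤ, -K ≤ j → j ≤ K → q (a + j) = u j) ∧
      ∀ j : ℤ, -K ≤ j → j ≤ K → q (b + j) = v j := by
  have hlang : ∀ x ∈ Y.carrier,
      List.ofFn (fun k : Fin (2 * K + 1) => x ((k : ℕ) - K)) ∈ Y.language := by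
    intro x hx
    refine ⟨x, hx, -K, fun k hk => ?_⟩
    rw [List.getElem_ofFn]
    congr 1
    ring
  obtain ⟨w, -, q, hq, i, hi⟩ := hY _ (hlang u hu) _ (hlang v hv)
  simp only [List.length_append, List.length_ofFn] at hi
  refine ⟨q, hq, i + K, i + (2 * K + 1) + w.length + K, by omega, fun j h₁ h₂ => ?_,
    fun j h₁ h₂ => ?_⟩
  · have := hi (j + K).toNat (by omega)
    rw [List.getElem_append_left (by simp; omega), List.getElem_append_left (by simp; omega),
      List.getElem_ofFn] at this
    rw [show i + K + j = i + ((j + K).toNat : ℕ) by omega, this]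
    exact congrArg u (show (((j + K).toNat : ℕ) : ℤ) - K = j by omega)
  · have := hi (2 * K + 1 + w.length + (j + K).toNat) (by omega)
    rw [List.getElem_append_right (by simp; omega), List.getElem_ofFn] at this
    convert this using 2
    · omega
    · simp only [List.length_append, List.length_ofFn]
      omega

lemma exists_window_subset [DiscreteTopology B] {Y : Subshift B ℤ} {U : Set Y.carrier}
    (hU : IsOpen U) {y : Y.carrier} (hy : y ∈ U) :
    ∃ K : ℕ, ∀ z : Y.carrier, (∀ j : ℤ, -K ≤ j → j ≤ K → z.1 j = y.1 j) → z ∈ U := by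
  obtain ⟨O, hO, rfl⟩ := isOpen_induced_iff.1 hU
  obtain ⟨K, hK⟩ := hO.exists_window_subset hy
  exact ⟨K, fun z hz => hK z.1 hz⟩

/-- The translation by `n` on a subshift. -/
def translate (Y : Subshift B ℤ) (n : ℤ) : Y.carrier → Y.carrier := (Y.mapsTo n).restrict

lemma translate_apply (Y : Subshift B ℤ) (n : ℤ) (y : Y.carrier) (i : ℤ) :
    (Y.translate n y).1 i = y.1 (n + i) := rfl

lemma shiftMap_translate (Y : Subshift B ℤ) (n : ℤ) (y : Y.carrier) :
    Y.shiftMap (Y.translate n y) = Y.translate (n + 1) y :=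
  Subtype.ext (funext fun i => congrArg y.1 (by ring : n + (1 + i) = n + 1 + i))

lemma IsFactorMap.apply_translate {Y : Subshift B ℤ} {X : Subshift A ℤ}
    {π : Y.carrier → X.carrier} (hπ : IsFactorMap π) (n : ℤ) (y : Y.carrier) (i : ℤ) :
    (π (Y.translate n y)).1 i = (π y).1 (n + i) := by
  have hstep : ∀ (n : ℤ) (i : ℤ),
      (π (Y.translate (n + 1) y)).1 i = (π (Y.translate n y)).1 (1 + i) := fun n i => by
    rw [← shiftMap_translate, hπ.2.2]; rfl
  induction n using Int.induction_on generalizing i with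
  | zero =>
    rw [zero_add, show Y.translate 0 y = y from
      Subtype.ext (funext fun i => congrArg y.1 (zero_add i))]
  | succ n ih => rw [hstep, ih]; exact congrArg (π y).1 (by ring)
  | pred n ih =>
    have h₁ := hstep (-n - 1) (-1 + i)
    have h₂ := ih (-1 + i)
    rw [sub_add_cancel] at h₁
    rw [h₁] at h₂
    rw [show 1 + (-1 + i) = i by ring] at h₂
    rw [h₂]; exact congrArg (π y).1 (by ring)

/-- The Curtis–Hedlund–Lyndon argument: a cluster point of counterexample pairs lies on the
diagonal, where continuity of `π` makes coordinate 0 of the image locally constant. -/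
lemma IsFactorMap.exists_local_rule [Finite B] [DiscreteTopology B] [DiscreteTopology A]
    {Y : Subshift B ℤ} {X : Subshift A ℤ} {π : Y.carrier → X.carrier} (hπ : IsFactorMap π) :
    ∃ R : ℕ, ∀ y z : Y.carrier, (∀ j : ℤ, -R ≤ j → j ≤ R → y.1 j = z.1 j) →
      (π y).1 0 = (π z).1 0 := by
  by_contra! hcon
  choose y z hyz hne using hcon
  obtain ⟨q, hq⟩ := exists_clusterSeq fun n j => ((y n).1 j, (z n).1 j)
  have hdiag : ∀ j, (q j).1 = (q j).2 := by
    intro j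
    obtain ⟨n, hn, h⟩ := hq j.natAbs
    rw [← h j (by omega) (by omega)]
    exact hyz n j (by omega) (by omega)
  have hqY : (fun j => (q j).1) ∈ Y.carrier := by
    refine Y.isClosed.mem_of_windows fun K => ?_
    obtain ⟨n, -, h⟩ := hq K
    exact ⟨_, (y n).2, fun j h₁ h₂ => by rw [← h j h₁ h₂]⟩
  have hopen : IsOpen {w : Y.carrier | (π w).1 0 = (π ⟨_, hqY⟩).1 0} :=
    (isOpen_discrete {(π ⟨_, hqY⟩).1 0}).preimage
      ((continuous_apply 0).comp (continuous_subtype_val.comp hπ.1))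
  obtain ⟨K, hK⟩ := exists_window_subset hopen (y := ⟨_, hqY⟩) rfl
  obtain ⟨n, -, h⟩ := hq K
  refine hne n ((hK (y n) fun j h₁ h₂ => ?_).trans (hK (z n) fun j h₁ h₂ => ?_).symm)
  · exact congrArg Prod.fst (h j h₁ h₂)
  · exact (congrArg Prod.snd (h j h₁ h₂)).trans (hdiag j).symm

/-- The central window of radius `R` of `y` around the coordinate `i`. -/
def window (R : ℕ) (y : ℤ → B) (i : ℤ) : Set.Icc (-(R : ℤ)) R → B := fun j => y (i + j)

/-- The transitions between overlapping windows of points of `Y`. -/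
def WindowStep (Y : Subshift B ℤ) (R : ℕ) (c d : Set.Icc (-(R : ℤ)) R → B) : Prop :=
  ∃ y ∈ Y.carrier, c = window R y 0 ∧ d = window R y 1

lemma isBiinfinitePath_window {Y : Subshift B ℤ} (R : ℕ) {y : ℤ → B} (hy : y ∈ Y.carrier) :
    IsBiinfinitePath (Y.WindowStep R) (window R y) := fun i =>
  ⟨_, translate_mem hy i, funext fun j => by simp [window],
    funext fun j => by simp [window, add_assoc]⟩

/-- Overlaps force every window to be read off from the central letters; the resulting sequence has
only allowed windows, so the memory bound puts it in `Y`. -/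
lemma exists_eq_window_of_isBiinfinitePath {Y : Subshift B ℤ} {R : ℕ}
    (hR : ∀ y : ℤ → B,
      (∀ i : ℤ, ∃ z ∈ Y.carrier, ∀ j : ℤ, -R ≤ j → j ≤ R → z j = y (i + j)) → y ∈ Y.carrier)
    {c : ℤ → Set.Icc (-(R : ℤ)) R → B} (hc : IsBiinfinitePath (Y.WindowStep R) c) :
    ∃ y ∈ Y.carrier, c = window R y := by
  have hstep : ∀ (i j : ℤ) (h₁ : -(R : ℤ) ≤ j) (h₂ : j + 1 ≤ R),
      c (i + 1) ⟨j, h₁, by omega⟩ = c i ⟨j + 1, by omega, h₂⟩ := by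
    intro i j h₁ h₂
    obtain ⟨z, -, hz₀, hz₁⟩ := hc i
    rw [hz₀, hz₁]
    exact congrArg z (by simp only []; ring)
  have hpos : ∀ (k : ℕ) (i : ℤ) (hk : (k : ℤ) ≤ R),
      c i ⟨k, by omega, hk⟩ = c (i + k) ⟨0, by omega, by omega⟩ := by
    intro k
    induction k with
    | zero => intro i hk; simp
    | succ k ih =>
      intro i hk
      have := (hstep i k (by omega) (by push_cast at hk; omega)).symm.trans
        (ih (i + 1) (by push_cast at hk; omega))
      rw [add_right_comm, add_assoc] at this
      exact_mod_cast this
  have hneg : ∀ (k : ℕ) (i : ℤ) (hk : (k : ℤ) ≤ R),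
      c i ⟨-k, by omega, by omega⟩ = c (i + -k) ⟨0, by omega, by omega⟩ := by
    intro k
    induction k with
    | zero => intro i hk; simp
    | succ k ih =>
      intro i hk
      push_cast at hk ⊢
      have h₁ := hstep (i - 1) (-(k + 1)) (by omega) (by omega)
      have h₂ := ih (i - 1) (by omega)
      simp only [sub_add_cancel, show -((k : ℤ) + 1) + 1 = -k by ring] at h₁
      rw [h₁, h₂]
      congr 1
      ring
  have hc' : c = window R fun i => c i ⟨0, by omega, by omega⟩ := by
    funext i ⟨j, h₁, h₂⟩
    obtain ⟨k, rfl | rfl⟩ := j.eq_nat_or_neg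
    · exact hpos k i h₂
    · exact hneg k i (by omega)
  refine ⟨_, hR _ fun i => ?_, hc'⟩
  obtain ⟨z, hz, hz₀, -⟩ := hc i
  refine ⟨z, hz, fun j h₁ h₂ => ?_⟩
  have e₁ := congrFun (congrFun hc' i) ⟨j, h₁, h₂⟩
  have e₂ := congrFun hz₀ ⟨j, h₁, h₂⟩
  simp only [window, zero_add] at e₁ e₂
  rw [← e₁, e₂]

/-- A subshift of almost finite type consists of the labels of the bi-infinite paths of a finite
graph in which paths with the same labels that meet are equal. -/
lemma IsAlmostFiniteType.exists_presentation [DiscreteTopology A] {X : Subshift A ℤ}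
    (hX : X.IsAlmostFiniteType) :
    ∃ (C : Type) (_ : Finite C) (T : C → C → Prop) (l : C → A), PathsSeparated T l ∧
      ∀ x : ℤ → A, x ∈ X.carrier ↔ ∃ c, IsBiinfinitePath T c ∧ ∀ i, l (c i) = x i := by
  classical
  obtain ⟨B, _, _, _, Y, π, hft, hirr, hπ, U, hU, ⟨y₀, hy₀⟩, hinj⟩ := hX
  obtain ⟨R₁, hR₁⟩ := hft.exists_memory
  obtain ⟨R₂, hR₂⟩ := hπ.exists_local_rule
  obtain ⟨K, hK⟩ := exists_window_subset hU hy₀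
  set R := max R₁ R₂ with hRdef
  have hR : ∀ y : ℤ → B,
      (∀ i : ℤ, ∃ z ∈ Y.carrier, ∀ j : ℤ, -R ≤ j → j ≤ R → z j = y (i + j)) → y ∈ Y.carrier := by
    refine fun y hy => hR₁ y fun i => ?_
    obtain ⟨z, hz, h⟩ := hy i
    exact ⟨z, hz, fun j h₁ h₂ => h j (by omega) (by omega)⟩
  -- The value on windows that do not occur in `Y` is arbitrary, since no bi-infinite path visits
  -- them.
  let l : (Set.Icc (-(R : ℤ)) R → B) → A := fun c =>
    if h : ∃ y : Y.carrier, c = window R y.1 0 then (π h.choose).1 0 else (π y₀).1 0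
  have hl₀ : ∀ y : Y.carrier, l (window R y.1 0) = (π y).1 0 := by
    intro y
    have h : ∃ z : Y.carrier, window R y.1 0 = window R z.1 0 := ⟨y, rfl⟩
    simp only [l, dif_pos h]
    refine hR₂ _ _ fun j h₁ h₂ => ?_
    have := congrFun h.choose_spec ⟨j, by omega, by omega⟩
    simp only [window, zero_add] at this
    exact this.symm
  have hl : ∀ (y : Y.carrier) (i : ℤ), l (window R y.1 i) = (π y).1 i := by
    intro y i
    have h := hl₀ (Y.translate i y)
    rw [hπ.apply_translate, add_zero] at h
    rw [← h]
    congr 1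
    funext j
    simp [window, translate_apply]
  refine ⟨Set.Icc (-(R : ℤ)) R → B, inferInstance, Y.WindowStep R, l, ?_, fun x => ⟨?_, ?_⟩⟩
  -- Injectivity of `π` on `U` gives the injective cylinder, and irreducibility of `Y` gives the
  -- connecting paths.
  · refine LocallyInjective.pathsSeparated ⟨window R y₀.1, isBiinfinitePath_window R y₀.2, K, ?_⟩ ?_
    · intro c hc c' hc' h h' hcc'
      obtain ⟨y, hy, rfl⟩ := exists_eq_window_of_isBiinfinitePath hR hc
      obtain ⟨z, hz, rfl⟩ := exists_eq_window_of_isBiinfinitePath hR hc'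
      have hU : ∀ w : Y.carrier, (∀ j : ℤ, -K ≤ j → j ≤ K → window R w.1 j = window R y₀.1 j) →
          w ∈ U := fun w hw => hK w fun j h₁ h₂ => by
        simpa [window] using congrFun (hw j h₁ h₂) ⟨0, by omega, by omega⟩
      have := hinj (hU ⟨y, hy⟩ h) (hU ⟨z, hz⟩ h') (Subtype.ext (funext fun i => by
        rw [← hl, ← hl]; exact hcc' i))
      rw [show y = z from congrArg Subtype.val this]
    · intro c hc c' hc'
      obtain ⟨y, hy, rfl⟩ := exists_eq_window_of_isBiinfinitePath hR hc
      obtain ⟨z, hz, rfl⟩ := exists_eq_window_of_isBiinfinitePath hR hc'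
      obtain ⟨q, hq, a, b, hab, ha, hb⟩ := hirr.exists_windows hy hz R
      refine ⟨_, isBiinfinitePath_window R (translate_mem hq a), (b - a).toNat, ?_, ?_⟩
      · funext ⟨j, h₁, h₂⟩
        simpa [window] using ha j h₁ h₂
      · funext ⟨j, h₁, h₂⟩
        simp only [window, zero_add]
        rw [← hb j h₁ h₂]
        congr 1
        omega
  · intro hx
    obtain ⟨y, hy⟩ := hπ.2.1 ⟨x, hx⟩
    exact ⟨_, isBiinfinitePath_window R y.2, fun i => by rw [hl, hy]⟩
  · rintro ⟨c, hc, hcx⟩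
    obtain ⟨y, hy, rfl⟩ := exists_eq_window_of_isBiinfinitePath hR hc
    have : x = (π ⟨y, hy⟩).1 := funext fun i => by rw [← hcx, ← hl]
    rw [this]
    exact (π ⟨y, hy⟩).2

end Recoding

end SymbolicDynamics.FullShift.Subshift

/-! ### Cutting and gluing rays -/

section Rays

variable {A : Type*}

/-- The right-ray of `p` that starts at the coordinate `n`. -/
def futureRay (p : ℤ → A) (n : ℤ) : ℕ → A := fun k => p (n + k)

/-- The left-ray of `p` that ends before the coordinate `n`, read from right to left. -/
def pastRay (p : ℤ → A) (n : ℤ) : ℕ → A := fun k => p (n - 1 - k)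

@[simp] lemma glueRays_natCast (z x : ℕ → A) (n : ℕ) : glueRays z x n = x n := rfl

lemma glueRays_of_nonneg (z x : ℕ → A) {i : ℤ} (hi : 0 ≤ i) : glueRays z x i = x i.toNat := by
  lift i to ℕ using hi
  rfl

lemma glueRays_of_neg (z x : ℕ → A) {i : ℤ} (hi : i < 0) :
    glueRays z x i = z (-i - 1).toNat := by
  obtain ⟨n, rfl⟩ := Int.eq_negSucc_of_lt_zero hi
  rw [show (-Int.negSucc n - 1).toNat = n by omega]
  rfl

lemma glueRays_past_future (p : ℤ → A) (n : ℤ) :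
    glueRays (pastRay p n) (futureRay p n) = fun i => p (n + i) := by
  funext i
  rcases lt_or_ge i 0 with hi | hi
  · rw [glueRays_of_neg _ _ hi]
    exact congrArg p (by omega)
  · rw [glueRays_of_nonneg _ _ hi]
    exact congrArg p (by omega)

lemma glueRays_consRay (a : A) (z x : ℕ → A) :
    glueRays (consRay a z) x = fun i => glueRays z (consRay a x) (1 + i) := by
  funext i
  match i with
  | Int.ofNat n => rw [show (1 : ℤ) + Int.ofNat n = ((n + 1 : ℕ) : ℤ) by simp [add_comm]]; rfl
  | Int.negSucc 0 => rfl
  | Int.negSucc (n + 1) =>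
    rw [show (1 : ℤ) + Int.negSucc (n + 1) = Int.negSucc n by omega]; rfl

end Rays

/-! ### Predecessor sets -/

namespace SymbolicDynamics.FullShift.Subshift

section Predecessors

variable {A : Type*} [TopologicalSpace A] {X : Subshift A ℤ}

lemma mem_predecessorSet {x z : ℕ → A} : z ∈ X.predecessorSet x ↔ glueRays z x ∈ X.carrier :=
  ⟨fun h => h.2, fun h => ⟨⟨_, h, fun n => by
    rw [glueRays_of_neg _ _ (by omega)]; congr 1; omega⟩, h⟩⟩

lemma futureRay_mem_rightRays {p : ℤ → A} (hp : p ∈ X.carrier) (n : ℤ) :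
    futureRay p n ∈ X.rightRays :=
  ⟨_, translate_mem hp n, fun _ => rfl⟩

lemma pastRay_mem_predecessorSet {p : ℤ → A} {n : ℤ} :
    pastRay p n ∈ X.predecessorSet (futureRay p n) ↔ p ∈ X.carrier := by
  rw [mem_predecessorSet, glueRays_past_future, translate_mem_iff]

lemma mem_predecessorSet_consRay {a : A} {x z : ℕ → A} :
    z ∈ X.predecessorSet (consRay a x) ↔ consRay a z ∈ X.predecessorSet x := by
  rw [mem_predecessorSet, mem_predecessorSet, glueRays_consRay, translate_mem_iff]

/-- The labels of the path are written in front of `y`. This works for any `y` representing the last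
vertex, because the predecessor set of a ray `a x` depends only on `a` and the predecessor set of
`x`. -/
lemma exists_predecessorSet_eq_of_isPath {A : Type u} [TopologicalSpace A] {X : Subshift A ℤ}
    {y : ℕ → A} {π : List X.leftKriegerCover.Edge} {v w : X.leftKriegerCover.Vertex}
    (hπ : X.leftKriegerCover.IsPath π v w) (hw : w.1 = X.predecessorSet y) :
    ∃ (q : ℕ → A) (k : ℕ), X.predecessorSet q = v.1 ∧ ∀ n, q (k + n) = y n := by
  induction π generalizing v with
  | nil =>
    obtain rfl : v = w := hπ
    exact ⟨y, 0, hw.symm, fun n => by rw [zero_add]⟩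
  | cons e π ih =>
    obtain ⟨rfl, hπ⟩ := hπ
    obtain ⟨q, k, hq, hk⟩ := ih hπ
    obtain ⟨x, -, -, h₁, h₂⟩ := e.2
    refine ⟨consRay e.1.2.1 q, k + 1, ?_, fun n => ?_⟩
    · have hqx : X.predecessorSet q = X.predecessorSet x := hq.trans h₂
      refine Eq.trans ?_ h₁.symm
      ext z
      rw [mem_predecessorSet_consRay, mem_predecessorSet_consRay, hqx]
    · rw [add_right_comm]
      exact hk n

/-- If the left Krieger cover is irreducible, then every predecessor set is the predecessor set of
a right-ray ending in any given right-ray. -/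
lemma exists_predecessorSet_eq_of_isIrreducible {A : Type u} [TopologicalSpace A]
    {X : Subshift A ℤ} (hX : X.leftKriegerCover.IsIrreducible) {x y : ℕ → A}
    (hx : x ∈ X.rightRays) (hy : y ∈ X.rightRays) :
    ∃ (q : ℕ → A) (k : ℕ), X.predecessorSet q = X.predecessorSet x ∧ ∀ n, q (k + n) = y n :=
  let ⟨_, hπ⟩ := hX ⟨_, x, hx, rfl⟩ ⟨_, y, hy, rfl⟩
  exists_predecessorSet_eq_of_isPath hπ rfl

lemma predecessorSet_eq_of_tail {x g q : ℕ → A} {M : ℕ} (hg : ∀ n < M, g n = x n)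
    (hgq : ∀ n, g (M + n) = q n)
    (hq : X.predecessorSet q = X.predecessorSet fun n => x (M + n)) :
    X.predecessorSet g = X.predecessorSet x := by
  ext z
  have hx : futureRay (glueRays z x) M = fun n => x (M + n) := funext fun n => by
    rw [futureRay, ← Nat.cast_add, glueRays_natCast]
  have hg' : futureRay (glueRays z g) M = q := funext fun n => by
    rw [futureRay, ← Nat.cast_add, glueRays_natCast, hgq]
  have hpast : pastRay (glueRays z g) M = pastRay (glueRays z x) M := funext fun n => by
    unfold pastRay
    rcases lt_or_ge ((M : ℤ) - 1 - n) 0 with hj | hj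
    · rw [glueRays_of_neg _ _ hj, glueRays_of_neg _ _ hj]
    · rw [glueRays_of_nonneg _ _ hj, glueRays_of_nonneg _ _ hj, hg _ (by omega)]
  rw [mem_predecessorSet, mem_predecessorSet, ← pastRay_mem_predecessorSet (n := (M : ℤ)),
    ← pastRay_mem_predecessorSet (p := glueRays z x) (n := (M : ℤ)), hx, hg', hpast, hq]

variable [DiscreteTopology A]

/-- A subshift is of finite type if the predecessor set of a right-ray depends only on a prefix
of bounded length. -/
lemma isFiniteType_of_predecessorSet_eq [Finite A] (N : ℕ)
    (h : ∀ x ∈ X.rightRays, ∀ y ∈ X.rightRays, (∀ n < N, x n = y n) →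
      X.predecessorSet x = X.predecessorSet y) : X.IsFiniteType := by
  refine ⟨{w | w.length = N + 1 ∧ w ∉ X.language},
    (List.finite_length_eq A (N + 1)).subset fun w hw => hw.1, Set.Subset.antisymm ?_ ?_⟩
  · exact fun x hx w hw hwx => hw.2 ⟨x, hx, hwx⟩
  intro x hx
  have hbase : ∀ i : ℤ, ∃ z ∈ X.carrier, ∀ n : ℕ, n < N + 1 → z n = x (i + n) := by
    intro i
    have hw : List.ofFn (fun k : Fin (N + 1) => x (i + (k : ℕ))) ∈ X.language := by
      by_contra hw
      exact hx _ ⟨List.length_ofFn, hw⟩ ⟨i, fun k hk => by rw [List.getElem_ofFn]⟩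
    obtain ⟨z, hz, m, hm⟩ := hw
    refine ⟨_, translate_mem hz m, fun n hn => ?_⟩
    have := hm n (by simpa using hn)
    rwa [List.getElem_ofFn] at this
  have hext : ∀ (k : ℕ) (i : ℤ), ∃ z ∈ X.carrier, ∀ n : ℕ, n < N + 1 + k → z n = x (i + n) := by
    intro k
    induction k with
    | zero => exact hbase
    | succ k ih =>
      intro i
      obtain ⟨z, hz, hzx⟩ := ih (i + 1)
      obtain ⟨z', hz', hzx'⟩ := hbase i
      -- The two futures share `N` letters, so the past of `z'`, whose last letter is `x i`, may be
      -- put in front of `z`.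
      have heq := h _ (futureRay_mem_rightRays hz' 1) _ (futureRay_mem_rightRays hz 0)
        fun n hn => by
          have := hzx' (n + 1) (by omega)
          simp only [futureRay, zero_add, hzx n (by omega)]
          rw [add_comm (1 : ℤ)]
          push_cast at this
          rw [this]
          congr 1
          ring
      have hmem := (pastRay_mem_predecessorSet (n := 1)).2 hz'
      rw [heq, mem_predecessorSet] at hmem
      refine ⟨_, translate_mem hmem (-1), fun n hn => ?_⟩
      rcases n with _ | n
      · have := hzx' 0 (by omega)
        rw [glueRays_of_neg _ _ (by simp)]
        simpa [pastRay] using this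
      · have := hzx n (by omega)
        rw [glueRays_of_nonneg _ _ (by omega),
          show (-1 + ((n + 1 : ℕ) : ℤ)).toNat = n by omega]
        simp only [futureRay, zero_add, this]
        congr 1
        push_cast
        ring
  refine X.isClosed.mem_of_windows fun K => ?_
  obtain ⟨z, hz, hzx⟩ := hext (2 * K) (-K)
  refine ⟨_, translate_mem hz K, fun j h₁ h₂ => ?_⟩
  have := hzx (K + j).toNat (by omega)
  rw [show (((K + j).toNat : ℕ) : ℤ) = K + j by omega] at this
  rw [this]
  congr 1
  ring

/-- A subshift not of finite type has a right-ray at which the predecessor set is not locally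
constant. -/
lemma exists_not_locally_constant_predecessorSet [Finite A] (hX : ¬ X.IsFiniteType) :
    ∃ x ∈ X.rightRays, ∀ N : ℕ, ∃ y ∈ X.rightRays, (∀ n < N, y n = x n) ∧
      X.predecessorSet y ≠ X.predecessorSet x := by
  by_contra! hcon
  have : ∀ N : ℕ, ∃ x ∈ X.rightRays, ∃ y ∈ X.rightRays, (∀ n < N, x n = y n) ∧
      X.predecessorSet x ≠ X.predecessorSet y := by
    by_contra! h
    obtain ⟨N, h⟩ := h
    exact hX (isFiniteType_of_predecessorSet_eq N h)
  choose x hx y hy hxy hne using this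
  choose p hp hpx using hx
  -- Local constancy at the cluster point contradicts the failure of every uniform bound `N`.
  obtain ⟨q, hq⟩ := exists_clusterSeq p
  have hqX : q ∈ X.carrier := X.isClosed.mem_of_windows fun K =>
    let ⟨n, _, h⟩ := hq K
    ⟨_, hp n, h⟩
  obtain ⟨N, hN⟩ := hcon _ (futureRay_mem_rightRays hqX 0)
  obtain ⟨n, hnN, hn⟩ := hq N
  have hxq : ∀ m < N, x n m = futureRay q 0 m := fun m hm => by
    rw [hpx n m, hn m (by omega) (by omega)]
    simp [futureRay]
  refine hne n ((hN (x n) ⟨p n, hp n, hpx n⟩ hxq).trans (hN (y n) (hy n) fun m hm => ?_).symm)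
  rw [← hxy n m (by omega), hxq m hm]

lemma predecessorSet_subset_of_frequently_eq {x : ℕ → A} {V : Set (ℕ → A)}
    (h : ∀ N : ℕ, ∃ y, (∀ n < N, y n = x n) ∧ X.predecessorSet y = V) :
    V ⊆ X.predecessorSet x := by
  intro z hz
  refine mem_predecessorSet.2 (X.isClosed.mem_of_windows fun K => ?_)
  obtain ⟨y, hyx, rfl⟩ := h (K + 1)
  refine ⟨_, mem_predecessorSet.1 hz, fun j _ h₂ => ?_⟩
  rcases lt_or_ge j 0 with hj | hj
  · rw [glueRays_of_neg _ _ hj, glueRays_of_neg _ _ hj]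
  · rw [glueRays_of_nonneg _ _ hj, glueRays_of_nonneg _ _ hj, hyx _ (by omega)]

end Predecessors

/-! ### Finite presentations and the main argument -/

section Presented

variable {A C : Type*} [TopologicalSpace A] {X : Subshift A ℤ} {T : C → C → Prop} {l : C → A}

/-- Over a finite presentation there are only finitely many predecessor sets, so some predecessor
set recurs in every sequence of right-rays. -/
lemma exists_infinite_predecessorSet_eq [Finite C]
    (hX : ∀ x : ℤ → A, x ∈ X.carrier ↔ ∃ c, IsBiinfinitePath T c ∧ ∀ i, l (c i) = x i)
    (t : ℕ → ℕ → A) : ∃ V, ∀ N, ∃ n ≥ N, X.predecessorSet (t n) = V := by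
  -- The set of vertices from which a ray can be read determines its predecessor set, and `C` has
  -- finitely many subsets.
  let E : (ℕ → A) → Set C := fun x =>
    {b | ∃ c, IsBiinfinitePath T c ∧ c 0 = b ∧ ∀ n : ℕ, l (c n) = x n}
  have hsub : ∀ x y, E x = E y → X.predecessorSet x ⊆ X.predecessorSet y := by
    intro x y hxy z hz
    obtain ⟨c, hc, hcx⟩ := (hX _).1 (mem_predecessorSet.1 hz)
    have : c 0 ∈ E y := hxy ▸ (⟨c, hc, rfl, fun n => hcx n⟩ : c 0 ∈ E x)
    obtain ⟨d, hd, hd₀, hdy⟩ := this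
    refine mem_predecessorSet.2 ((hX _).2 ⟨_, hc.splice hd (i := 0) hd₀.symm, fun i => ?_⟩)
    rcases lt_trichotomy i 0 with hi | rfl | hi
    · rw [if_pos hi.le, hcx, glueRays_of_neg _ _ hi, glueRays_of_neg _ _ hi]
    · rw [if_pos le_rfl, ← hd₀]
      exact hdy 0
    · rw [if_neg (by omega)]
      lift i to ℕ using hi.le
      exact hdy i
  obtain ⟨S, hS⟩ := Finite.exists_infinite_fiber fun n => E (t n)
  have hS := Set.infinite_coe_iff.1 hS
  obtain ⟨m, hm⟩ := hS.nonempty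
  refine ⟨X.predecessorSet (t m), fun N => ?_⟩
  obtain ⟨n, hn, hN⟩ := hS.exists_gt N
  have heq : E (t n) = E (t m) := Eq.trans hn (Eq.symm hm)
  exact ⟨n, hN.le, (hsub _ _ heq).antisymm (hsub _ _ heq.symm)⟩

end Presented

/-- A subshift with a finite presentation in which paths with the same labels that meet are equal
is of finite type if its left Krieger cover is irreducible. -/
lemma isFiniteType_of_isIrreducible_leftKriegerCover {A : Type u} [Finite A] [TopologicalSpace A]
    [DiscreteTopology A] {X : Subshift A ℤ} {C : Type*} [Finite C] {T : C → C → Prop} {l : C → A}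
    (hs : PathsSeparated T l)
    (hX : ∀ x : ℤ → A, x ∈ X.carrier ↔ ∃ c, IsBiinfinitePath T c ∧ ∀ i, l (c i) = x i)
    (hK : X.leftKriegerCover.IsIrreducible) : X.IsFiniteType := by
  by_contra hft
  obtain ⟨x, hx, hbad⟩ := exists_not_locally_constant_predecessorSet hft
  choose t ht htx htne using hbad
  obtain ⟨V, hV⟩ := exists_infinite_predecessorSet_eq hX t
  have hVx : V ⊆ X.predecessorSet x := predecessorSet_subset_of_frequently_eq fun N =>
    let ⟨n, hn, h⟩ := hV N
    ⟨t n, fun m hm => htx n m (by omega), h⟩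
  have hne : ∃ c, IsBiinfinitePath T c :=
    let ⟨z, hz, _⟩ := hx
    let ⟨c, hc, _⟩ := (hX z).1 hz
    ⟨c, hc⟩
  obtain ⟨D, hD⟩ := hs.exists_delay
  obtain ⟨p, hp, L, hmagic⟩ := hs.exists_magic hne
  have hpX : (fun i => l (p i)) ∈ X.carrier := (hX _).2 ⟨p, hp, fun _ => rfl⟩
  -- Agreement on the coordinates from 0 to 2D leaves the coordinate D at distance `D` from both
  -- ends.
  obtain ⟨N₁, hN₁, hVN⟩ := hV (2 * D + 1)
  set y := t N₁ with hy
  have hyx : ∀ n < 2 * D + 1, y n = x n := fun n hn => htx N₁ n (by omega)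
  -- Every right-ray of `X` extends to the left by a ray containing the magic word.
  have hleft : ∀ r ∈ X.rightRays, ∃ z ∈ X.predecessorSet r, ∃ a : ℤ, a + L < 0 ∧
      ∀ j : ℤ, -L ≤ j → j ≤ L → glueRays z r (a + j) = l (p j) := by
    intro r hr
    -- The past of `p` before `L + 1` contains the whole magic window; it may precede `q`, which
    -- ends in `r`.
    obtain ⟨q, k, hq, hqr⟩ :=
      exists_predecessorSet_eq_of_isIrreducible hK (futureRay_mem_rightRays hpX (L + 1)) hr
    have hu := (pastRay_mem_predecessorSet (n := L + 1)).2 hpX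
    rw [← hq, mem_predecessorSet] at hu
    set u := glueRays (pastRay (fun i => l (p i)) (L + 1)) q with hu_def
    have hur : futureRay u k = r := funext fun n => by
      rw [futureRay, ← Nat.cast_add, hu_def, glueRays_natCast, hqr]
    refine ⟨pastRay u k, ?_, -(L + 1) - k, by omega, fun j h₁ h₂ => ?_⟩
    · rw [← hur]
      exact pastRay_mem_predecessorSet.2 hu
    · rw [← hur, glueRays_past_future]
      beta_reduce
      rw [hu_def, glueRays_of_neg _ _ (by omega)]
      exact congrArg (fun i => l (p i)) (by omega)
  -- A left-ray containing the magic word that distinguishes `x` from `y`.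
  obtain ⟨s, hs₁, hs₂, a, ha, hsa⟩ : ∃ s ∈ X.predecessorSet x, s ∉ X.predecessorSet y ∧
      ∃ a : ℤ, a + L < 0 ∧ ∀ j : ℤ, -L ≤ j → j ≤ L → glueRays s x (a + j) = l (p j) := by
    obtain ⟨s, hs₁, hs₂⟩ : ∃ s ∈ X.predecessorSet x, s ∉ X.predecessorSet y := by
      by_contra! hcon
      refine htne N₁ (Set.Subset.antisymm ?_ hcon)
      rw [hVN]
      exact hVx
    rw [mem_predecessorSet] at hs₁ hs₂
    -- Being excluded before `y` is decided by finitely many letters of `s`, so the part of `s`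
    -- further left can be replaced by a ray with the magic word.
    obtain ⟨N, hN⟩ := X.isClosed.isOpen_compl.exists_window_subset (x := glueRays s y) hs₂
    obtain ⟨z, hz, a, ha, hza⟩ := hleft _ (futureRay_mem_rightRays hs₁ (-N))
    set r := futureRay (glueRays s x) (-N) with hr
    rw [mem_predecessorSet] at hz
    have hfut : futureRay (glueRays z r) N = x := funext fun n => by
      rw [futureRay, ← Nat.cast_add, glueRays_natCast, hr, futureRay]
      push_cast
      rw [neg_add_cancel_left, glueRays_natCast]
    have hglue := glueRays_past_future (glueRays z r) N
    rw [hfut] at hglue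
    refine ⟨pastRay (glueRays z r) N, ?_, fun hcon => ?_, a - N, by omega, fun j h₁ h₂ => ?_⟩
    · rw [mem_predecessorSet, hglue]
      exact translate_mem hz N
    · refine hN _ (fun j h₁ h₂ => ?_) (mem_predecessorSet.1 hcon)
      rcases lt_or_ge j 0 with hj | hj
      · rw [glueRays_of_neg _ _ hj, pastRay, glueRays_of_nonneg _ _ (by omega), hr, futureRay]
        rw [glueRays_of_neg _ _ (by omega), glueRays_of_neg _ _ hj]
        exact congrArg s (by omega)
      · rw [glueRays_of_nonneg _ _ hj, glueRays_of_nonneg _ _ hj]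
    · rw [hglue, ← hza j h₁ h₂]
      exact congrArg (glueRays z r) (by ring)
  obtain ⟨z, hz, b, hb, hzb⟩ := hleft y (ht N₁)
  have hzx : z ∈ X.predecessorSet x := hVx (hVN ▸ hz)
  -- A right-ray with the predecessor set of `x` and a long common prefix and the magic word.
  obtain ⟨g, hgx, hg, f, hf, hgf⟩ : ∃ g : ℕ → A, (∀ n < 2 * D + 1, g n = x n) ∧
      X.predecessorSet g = X.predecessorSet x ∧ ∃ f : ℤ, 2 * D + 1 + L ≤ f ∧
        ∀ z, ∀ j : ℤ, -L ≤ j → j ≤ L → glueRays z g (f + j) = l (p j) := by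
    have hx' : (fun n => x (2 * D + 1 + n)) ∈ X.rightRays := by
      obtain ⟨w, hw, hwx⟩ := hx
      refine ⟨_, translate_mem hw (2 * D + 1 : ℕ), fun n => ?_⟩
      exact (hwx _).trans (congrArg w (Nat.cast_add _ _))
    obtain ⟨q, k, hq, hqp⟩ :=
      exists_predecessorSet_eq_of_isIrreducible hK hx' (futureRay_mem_rightRays hpX (-L))
    have hlt : ∀ n < 2 * D + 1, (if n < 2 * D + 1 then x n else q (n - (2 * D + 1))) = x n :=
      fun n hn => if_pos hn
    refine ⟨fun n => if n < 2 * D + 1 then x n else q (n - (2 * D + 1)), hlt,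
      predecessorSet_eq_of_tail hlt (fun n => by
        rw [if_neg (by omega), Nat.add_sub_cancel_left]) hq, 2 * D + 1 + k + L, by omega,
      fun z j h₁ h₂ => ?_⟩
    rw [glueRays_of_nonneg _ _ (by omega), if_neg (by omega),
      show (2 * (D : ℤ) + 1 + k + L + j).toNat - (2 * D + 1) = k + (L + j).toNat by omega, hqp]
    exact congrArg (fun i => l (p i)) (by omega)
  rw [← hg] at hzx
  have hsg := hs₁
  rw [← hg] at hsg
  rw [mem_predecessorSet] at hs₁ hs₂ hz hzx hsg
  -- Lift the four points and compare the lifts at the coordinate `D`.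
  have hneg : ∀ (z r r' : ℕ → A) (i : ℤ), i < 0 → glueRays z r i = glueRays z r' i :=
    fun z r r' i hi => by rw [glueRays_of_neg _ _ hi, glueRays_of_neg _ _ hi]
  have hnonneg : ∀ (z z' r : ℕ → A) (i : ℤ), 0 ≤ i → glueRays z r i = glueRays z' r i :=
    fun z z' r i hi => by rw [glueRays_of_nonneg _ _ hi, glueRays_of_nonneg _ _ hi]
  have hle : ∀ (z r r' : ℕ → A), (∀ n < 2 * D + 1, r n = r' n) → ∀ i : ℤ, i ≤ 2 * D →
      glueRays z r i = glueRays z r' i := fun z r r' h i hi => by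
    rcases lt_or_ge i 0 with hi' | hi'
    · exact hneg z r r' i hi'
    · rw [glueRays_of_nonneg _ _ hi', glueRays_of_nonneg _ _ hi', h _ (by omega)]
  obtain ⟨c₁, hc₁, hl₁⟩ := (hX _).1 hs₁
  obtain ⟨c₂', hc₂', hl₂'⟩ := (hX _).1 hsg
  obtain ⟨c₃', hc₃', hl₃'⟩ := (hX _).1 hzx
  obtain ⟨c₄', hc₄', hl₄'⟩ := (hX _).1 hz
  -- The lifts are chosen in a chain: sx and sg meet in s at `a`, sg and zg meet in g at `f`, zg and
  -- zy meet in z at `b`.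
  obtain ⟨c₂, hc₂, hl₂, h₁₂⟩ := hmagic c₁ hc₁ c₂' hc₂' a a
    (fun j h₁ h₂ => by rw [hl₁, hsa j h₁ h₂])
    (fun j h₁ h₂ => by rw [hl₂', ← hsa j h₁ h₂, hneg _ _ _ _ (by omega)])
  obtain ⟨c₃, hc₃, hl₃, h₂₃⟩ := hmagic c₂ hc₂ c₃' hc₃' f f
    (fun j h₁ h₂ => by rw [hl₂, hl₂', hgf _ j h₁ h₂])
    (fun j h₁ h₂ => by rw [hl₃', hgf _ j h₁ h₂])
  obtain ⟨c₄, hc₄, hl₄, h₃₄⟩ := hmagic c₃ hc₃ c₄' hc₄' b b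
    (fun j h₁ h₂ => by rw [hl₃, hl₃', ← hzb j h₁ h₂, hneg _ _ _ _ (by omega)])
    (fun j h₁ h₂ => by rw [hl₄', hzb j h₁ h₂])
  simp only [hl₂'] at hl₂
  simp only [hl₃'] at hl₃
  simp only [hl₄'] at hl₄
  have e₁₂ : c₂ D = c₁ D := hD c₂ hc₂ c₁ hc₁ a a (2 * D) h₁₂ le_rfl (by omega)
    (fun j _ hj => by rw [hl₁, hl₂, hle _ _ _ hgx j hj]) D (by omega) (by omega)
  have e₂₃ : c₃ D = c₂ D := hD c₃ hc₃ c₂ hc₂ f 0 f h₂₃ (by omega) le_rfl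
    (fun j hj _ => by rw [hl₃, hl₂, hnonneg _ _ _ j hj]) D (by omega) (by omega)
  have e₃₄ : c₄ D = c₃ D := hD c₄ hc₄ c₃ hc₃ b b (2 * D) h₃₄ le_rfl (by omega)
    (fun j _ hj => by
      rw [hl₄, hl₃, hle _ _ _ (fun n hn => (hyx n hn).trans (hgx n hn).symm) j hj])
    D (by omega) (by omega)
  -- The spliced path reads s and the common prefix up to D, then the rest of `y`, so it presents
  -- the excluded point sy.
  refine hs₂ ((hX _).2 ⟨_, hc₁.splice hc₄ (e₃₄.trans (e₂₃.trans e₁₂)).symm, fun i => ?_⟩)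
  split_ifs with hi
  · rw [hl₁, hle _ _ _ hyx i (by omega)]
  · rw [hl₄, hnonneg _ _ _ i (by omega)]

end SymbolicDynamics.FullShift.Subshift

theorem theorem3 {A : Type*} [Finite A] [TopologicalSpace A] [DiscreteTopology A]
    (X : SymbolicDynamics.FullShift.Subshift A ℤ)
    (hirr : X.IsIrreducible) (hsofic : X.IsStrictlySofic) (haft : X.IsAlmostFiniteType) :
    X.leftKriegerCover.IsReducible := by
  intro hK
  obtain ⟨C, _, T, l, hs, hX⟩ := haft.exists_presentation
  exact hsofic.2 (Subshift.isFiniteType_of_isIrreducible_leftKriegerCover hs hX hK)
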